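/- Let $k$ be a field. A Poisson algebra over $k$ is a commutative associative unital $k$-algebra $P$ with a $k$-bilinear Lie bracket $[-,-]$ such that $[p,qr]=[p,q]r+q[p,r]$ for all $p,q,r\in P$. If $P_1,P_2$ are Poisson algebras, then $P_1\otimes P_2$ is a Poisson algebra with $[p\otimes q,\,r\otimes s]=pr\otimes[q,s]+[p,r]\otimes qs$, and $k$ is a Poisson algebra with the zero bracket. A Poisson Hopf algebra over $k$ is a commutative Hopf algebra $H$ over $k$ with a Poisson algebra structure on its underlying algebra such that the comultiplication $\Delta:H\to H\otimes H$ and the counit $\varepsilon:H\to k$ preserve the brackets. A morphism of Poisson Hopf algebras is a map that is both a morphism of Poisson algebras (an algebra map preserving the brackets) and a morphism of coalgebras. Theorem. The forgetful functor $F$ from the category of Poisson Hopf algebras over $k$ to the category of (coassociative, counital) $k$-coalgebras has a left adjoint; that is, there is a free Poisson Hopf algebra on every coalgebra: for every $k$-coalgebra $C$ there are a Poisson Hopf algebra $H$ and a coalgebra map $i:C\to F(H)$ such that for every Poisson Hopf algebra $Y$ and every coalgebra map $f:C\to F(Y)$ there is a unique morphism of Poisson Hopf algebras $g:H\to Y$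 with $F(g)\circ i=f$. -/

import Mathlib

open CategoryTheory
open scoped TensorProduct

universe u v

/-- A Poisson algebra over `k`: a commutative associative unital `k`-algebra `A` with a `k`-bilinear
bracket which is a Lie bracket (alternating, Jacobi identity) and such that every `[a, -]` is a
derivation of the associative product. (Mathlib's `LieRing` is not used since it would carry a second
addition on `A`, and since Mathlib's global bracket on a ring is the commutator.) -/
class PoissonAlgebra (k : Type u) (A : Type v) [Field k] [CommRing A] [Algebra k A] where
  /-- The Poisson bracket. -/
  bracket : A →ₗ[k] A →ₗ[k] A
  bracket_self : ∀ a : A, bracket a a = 0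
  jacobi : ∀ a b c : A,
    bracket a (bracket b c) + bracket b (bracket c a) + bracket c (bracket a b) = 0
  leibniz : ∀ a b c : A, bracket a (b * c) = bracket a b * c + b * bracket a c

namespace PoissonAlgebra

section

variable {k : Type u} {A B : Type*} [Field k] [CommRing A] [Algebra k A] [PoissonAlgebra k A]
  [CommRing B] [Algebra k B] [PoissonAlgebra k B]

theorem bracket_skew (a b : A) : bracket (k := k) a b = -bracket (k := k) b a := by
  have h := bracket_self (k := k) (a + b)
  simp only [map_add, LinearMap.add_apply, bracket_self, zero_add, add_zero] at h
  exact eq_neg_of_add_eq_zero_right h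

variable (k A B) in
/-- The bracket on `A ⊗ B`: `[p ⊗ q, r ⊗ s] = pr ⊗ [q, s] + [p, r] ⊗ qs`, extended bilinearly. -/
noncomputable def tensorBracket : A ⊗[k] B →ₗ[k] A ⊗[k] B →ₗ[k] A ⊗[k] B :=
  TensorProduct.map₂ (LinearMap.mul k A) (bracket (k := k) (A := B)) +
    TensorProduct.map₂ (bracket (k := k) (A := A)) (LinearMap.mul k B)

theorem tensorBracket_tmul (p r : A) (q s : B) :
    tensorBracket k A B (p ⊗ₜ q) (r ⊗ₜ s) =
      (p * r) ⊗ₜ[k] bracket (k := k) q s + bracket (k := k) p r ⊗ₜ[k] (q * s) := by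
  simp [tensorBracket]

theorem tensorBracket_skew (x y : A ⊗[k] B) :
    tensorBracket k A B x y = -tensorBracket k A B y x := by
  induction x using TensorProduct.induction_on with
  | zero => simp
  | add x₁ x₂ h₁ h₂ => simp only [map_add, LinearMap.add_apply, h₁, h₂, neg_add]
  | tmul p q =>
    induction y using TensorProduct.induction_on with
    | zero => simp
    | add y₁ y₂ h₁ h₂ => simp only [map_add, LinearMap.add_apply, h₁, h₂, neg_add]
    | tmul r s =>
      rw [tensorBracket_tmul, tensorBracket_tmul, bracket_skew q s, bracket_skew p r,
        mul_comm p r, mul_comm q s, TensorProduct.tmul_neg, TensorProduct.neg_tmul, neg_add]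

theorem tensorBracket_self (x : A ⊗[k] B) : tensorBracket k A B x x = 0 := by
  induction x using TensorProduct.induction_on with
  | zero => simp
  | add x₁ x₂ h₁ h₂ =>
    simp only [map_add, LinearMap.add_apply, h₁, h₂, zero_add, add_zero]
    rw [tensorBracket_skew x₂ x₁, neg_add_cancel]
  | tmul p q => simp [tensorBracket_tmul, bracket_self]

theorem tensorBracket_leibniz (x y z : A ⊗[k] B) :
    tensorBracket k A B x (y * z) =
      tensorBracket k A B x y * z + y * tensorBracket k A B x z := by
  induction x using TensorProduct.induction_on with
  | zero => simp
  | add x₁ x₂ h₁ h₂ => simp only [map_add, LinearMap.add_apply, h₁, h₂]; ring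
  | tmul p q =>
    induction y using TensorProduct.induction_on with
    | zero => simp
    | add y₁ y₂ h₁ h₂ => simp only [map_add, add_mul, h₁, h₂]; ring
    | tmul r s =>
      induction z using TensorProduct.induction_on with
      | zero => simp
      | add z₁ z₂ h₁ h₂ => simp only [map_add, mul_add, h₁, h₂]; ring
      | tmul t w =>
        have e : ∀ (a : A) (b : B), a ⊗ₜ[k] b =
            Algebra.TensorProduct.includeLeft (R := k) (S := k) (B := B) a *
              Algebra.TensorProduct.includeRight (R := k) (A := A) b := by simp
        simp only [Algebra.TensorProduct.tmul_mul_tmul, tensorBracket_tmul, leibniz]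
        simp only [e, map_mul, map_add]
        ring

theorem tensorBracket_jacobi (x y z : A ⊗[k] B) :
    tensorBracket k A B x (tensorBracket k A B y z) +
      tensorBracket k A B y (tensorBracket k A B z x) +
      tensorBracket k A B z (tensorBracket k A B x y) = 0 := by
  induction x using TensorProduct.induction_on with
  | zero => simp
  | add x₁ x₂ h₁ h₂ =>
    simp only [map_add, LinearMap.add_apply]
    linear_combination h₁ + h₂
  | tmul p q =>
    induction y using TensorProduct.induction_on with
    | zero => simp
    | add y₁ y₂ h₁ h₂ =>
      simp only [map_add, LinearMap.add_apply]
      linear_combination h₁ + h₂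
    | tmul r s =>
      induction z using TensorProduct.induction_on with
      | zero => simp
      | add z₁ z₂ h₁ h₂ =>
        simp only [map_add, LinearMap.add_apply]
        linear_combination h₁ + h₂
      | tmul t w =>
        have e : ∀ (a : A) (b : B), a ⊗ₜ[k] b =
            Algebra.TensorProduct.includeLeft (R := k) (S := k) (B := B) a *
              Algebra.TensorProduct.includeRight (R := k) (A := A) b := by simp
        have hA := congrArg (Algebra.TensorProduct.includeLeft (R := k) (S := k) (B := B))
          (jacobi (k := k) p r t)
        have hB := congrArg (Algebra.TensorProduct.includeRight (R := k) (A := A))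
          (jacobi (k := k) q s w)
        simp only [tensorBracket_tmul, map_add, leibniz]
        rw [bracket_skew p t, bracket_skew r p, bracket_skew t r,
          bracket_skew q w, bracket_skew s q, bracket_skew w s]
        simp only [e, map_mul, map_add, map_neg, map_zero] at hA hB ⊢
        linear_combination
          Algebra.TensorProduct.includeLeft (R := k) (S := k) (B := B) p * Algebra.TensorProduct.includeLeft (R := k) (S := k) (B := B) r *
            Algebra.TensorProduct.includeLeft (R := k) (S := k) (B := B) t * hB +
          Algebra.TensorProduct.includeRight (R := k) (A := A) q * Algebra.TensorProduct.includeRight (R := k) (A := A) s *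
            Algebra.TensorProduct.includeRight (R := k) (A := A) w * hA

/-- The tensor product of two Poisson algebras is a Poisson algebra. -/
noncomputable instance instTensorProduct : PoissonAlgebra k (A ⊗[k] B) where
  bracket := tensorBracket k A B
  bracket_self := tensorBracket_self
  jacobi := tensorBracket_jacobi
  leibniz := tensorBracket_leibniz

/-- The ground field with its only Poisson bracket, the zero bracket. -/
noncomputable instance instSelf : PoissonAlgebra k k where
  bracket := 0
  bracket_self := by simp
  jacobi := by simp
  leibniz := by simp

end

end PoissonAlgebra

/-- A linear map between Poisson algebras preserves the Poisson brackets. -/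
def PreservesBracket {k : Type u} {A B : Type*} [Field k] [CommRing A] [Algebra k A]
    [PoissonAlgebra k A] [CommRing B] [Algebra k B] [PoissonAlgebra k B] (f : A →ₗ[k] B) : Prop :=
  ∀ a b : A, f (PoissonAlgebra.bracket (k := k) a b) = PoissonAlgebra.bracket (k := k) (f a) (f b)

/-- A commutative bialgebra with a Poisson bracket is a Poisson bialgebra if its comultiplication
and its counit, which are already algebra maps, are morphisms of Poisson algebras. -/
class IsPoissonBialgebra (k : Type u) (A : Type v) [Field k] [CommRing A] [Bialgebra k A]
    [PoissonAlgebra k A] : Prop where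
  comul_bracket : PreservesBracket (Coalgebra.comul : A →ₗ[k] A ⊗[k] A)
  counit_bracket : PreservesBracket (Coalgebra.counit : A →ₗ[k] k)

/-- A Poisson Hopf algebra over `k`: a Poisson bialgebra which is a Hopf algebra. -/
structure PoissHopfCat (k : Type u) [Field k] where
  /-- The underlying type. -/
  carrier : Type v
  [instCommRing : CommRing carrier]
  [instHopfAlgebra : HopfAlgebra k carrier]
  [instPoissonAlgebra : PoissonAlgebra k carrier]
  [instIsPoissonBialgebra : IsPoissonBialgebra k carrier]

namespace PoissHopfCat

attribute [instance] instCommRing instHopfAlgebra instPoissonAlgebra instIsPoissonBialgebra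

variable {k : Type u} [Field k]

instance : CoeSort (PoissHopfCat.{u, v} k) (Type v) := ⟨carrier⟩

/-- A morphism of Poisson Hopf algebras: an algebra map which is a coalgebra map and preserves the
Poisson bracket. (Such a map commutes with the antipodes automatically.) -/
@[ext]
structure Hom (G H : PoissHopfCat.{u, v} k) where
  /-- The underlying morphism of bialgebras. -/
  toBialgHom : G →ₐc[k] H
  map_bracket : PreservesBracket (toBialgHom : G →ₗ[k] H)

/-- The category of Poisson Hopf algebras over `k`. -/
instance category : Category (PoissHopfCat.{u, v} k) where
  Hom G H := Hom G H
  id G := ⟨BialgHom.id k G, fun _ _ => rfl⟩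
  comp f g := ⟨g.toBialgHom.comp f.toBialgHom, fun a b =>
    (congrArg g.toBialgHom (f.map_bracket a b)).trans (g.map_bracket _ _)⟩

/-- The forgetful functor from Poisson Hopf algebras to coalgebras. -/
def forgetCoalg (k : Type u) [Field k] : PoissHopfCat.{u, v} k ⥤ CoalgCat.{v} k where
  obj H := CoalgCat.of k H
  map f := CoalgCat.ofHom (f.toBialgHom : _ →ₗc[k] _)

end PoissHopfCat

/-! The antipode is added as a formal operation. Let `P` be the free Poisson algebra on the linear
space `C` with a linear operator `op`, built as terms modulo laws. A map out of `P` is determined by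
a linear map from `C` and an operator on the target. The target `P ⊗ P` with operator `a ⊗ b ↦ op b
⊗ op a` yields a comultiplication, and `k` with the identity operator yields a counit. Induction on
terms (`comulHom_coassoc`, `counitHom_comulHom`) makes `P` a Poisson bialgebra.

Next impose `op * id = 1 = id * op` (convolution) at every element of `P`. Since convolution is not
an operation on terms, `AntipodeRel` relates arbitrary terms representing the two sides. The main
point is that these relations are compatible with the coalgebra structure. If `q` is the projection
to the quotient, then `(q ⊗ q) ∘ Δ` has as convolution inverse the flip of `(op q ⊗ op q) ∘ Δ`,
which is what the twisted operator on the tensor square produces. So the quotient is a Hopf algebra.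

For a Poisson Hopf algebra `Y`, the antipode reverses the comultiplication, so a coalgebra map `C →
Y` extends to a bialgebra map on `P`. It respects the relations by the antipode identities of `Y`.
Uniqueness holds because bialgebra maps between Hopf algebras commute with antipodes. -/

/-! ### Terms and their evaluation. -/

/-- The terms of the language of Poisson algebras over `k` with a linear operator, with generators
in `C`. -/
inductive PoissonTerm (k : Type*) (C : Type*)
  | of (c : C)
  | scalar (r : k)
  | add (a b : PoissonTerm k C)
  | mul (a b : PoissonTerm k C)
  | bracket (a b : PoissonTerm k C)
  | op (a : PoissonTerm k C)

namespace PoissonTerm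

section

variable {k : Type*} [Field k] {C : Type*} [AddCommGroup C] [Module k C]

/-- The laws of Poisson algebras over `k` with a linear operator and a linear map from `C`, together
with the relations `R`. -/
inductive Rel (R : PoissonTerm k C → PoissonTerm k C → Prop) :
    PoissonTerm k C → PoissonTerm k C → Prop
  | rel {a b} : R a b → Rel R a b
  | add_left {a b} (c) : Rel R a b → Rel R (add a c) (add b c)
  | add_right {a b} (c) : Rel R a b → Rel R (add c a) (add c b)
  | mul_left {a b} (c) : Rel R a b → Rel R (mul a c) (mul b c)
  | mul_right {a b} (c) : Rel R a b → Rel R (mul c a) (mul c b)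
  | bracket_left {a b} (c) : Rel R a b → Rel R (bracket a c) (bracket b c)
  | bracket_right {a b} (c) : Rel R a b → Rel R (bracket c a) (bracket c b)
  | op_congr {a b} : Rel R a b → Rel R (op a) (op b)
  | add_comm (a b) : Rel R (add a b) (add b a)
  | add_assoc (a b c) : Rel R (add (add a b) c) (add a (add b c))
  | zero_add (a) : Rel R (add (scalar 0) a) a
  | neg_add_cancel (a) : Rel R (add (mul (scalar (-1)) a) a) (scalar 0)
  | mul_comm (a b) : Rel R (mul a b) (mul b a)
  | mul_assoc (a b c) : Rel R (mul (mul a b) c) (mul a (mul b c))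
  | zero_mul (a) : Rel R (mul (scalar 0) a) (scalar 0)
  | one_mul (a) : Rel R (mul (scalar 1) a) a
  | mul_add (a b c) : Rel R (mul a (add b c)) (add (mul a b) (mul a c))
  | scalar_add (r s) : Rel R (scalar (r + s)) (add (scalar r) (scalar s))
  | scalar_mul (r s) : Rel R (scalar (r * s)) (mul (scalar r) (scalar s))
  | of_add (c d) : Rel R (of (c + d)) (add (of c) (of d))
  | of_smul (r c) : Rel R (of (r • c)) (mul (scalar r) (of c))
  | op_add (a b) : Rel R (op (add a b)) (add (op a) (op b))
  | op_smul (r a) : Rel R (op (mul (scalar r) a)) (mul (scalar r) (op a))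
  | bracket_add (a b c) : Rel R (bracket a (add b c)) (add (bracket a b) (bracket a c))
  | bracket_smul (r a b) : Rel R (bracket a (mul (scalar r) b)) (mul (scalar r) (bracket a b))
  | add_bracket (a b c) : Rel R (bracket (add a b) c) (add (bracket a c) (bracket b c))
  | smul_bracket (r a b) : Rel R (bracket (mul (scalar r) a) b) (mul (scalar r) (bracket a b))
  | bracket_self (a) : Rel R (bracket a a) (scalar 0)
  | jacobi (a b c) : Rel R (add (add (bracket a (bracket b c)) (bracket b (bracket c a)))
      (bracket c (bracket a b))) (scalar 0)
  | leibniz (a b c) : Rel R (bracket a (mul b c)) (add (mul (bracket a b) c) (mul b (bracket a c)))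

variable {A : Type*} [CommRing A] [Algebra k A] [PoissonAlgebra k A]

/-- The value of a term in a Poisson algebra with operator `s`, for values `f` of the generators. -/
def eval (s : A →ₗ[k] A) (f : C →ₗ[k] A) : PoissonTerm k C → A
  | of c => f c
  | scalar r => algebraMap k A r
  | add a b => eval s f a + eval s f b
  | mul a b => eval s f a * eval s f b
  | bracket a b => PoissonAlgebra.bracket (k := k) (eval s f a) (eval s f b)
  | op a => s (eval s f a)

/-- Only `R` needs checking: every other constructor is a congruence rule or a law valid in any
Poisson algebra with linear `s` and `f`. -/
theorem eval_eq_of_rel {R : PoissonTerm k C → PoissonTerm k C → Prop} (s : A →ₗ[k] A)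
    (f : C →ₗ[k] A) (h : ∀ a b, R a b → eval s f a = eval s f b) {a b : PoissonTerm k C}
    (hab : Rel R a b) : eval s f a = eval s f b := by
  induction hab with
  | rel hab => exact h _ _ hab
  | jacobi a b c => simpa [eval] using PoissonAlgebra.jacobi (k := k) _ _ _
  | leibniz a b c => simpa [eval] using PoissonAlgebra.leibniz (k := k) _ _ _
  | add_comm => exact _root_.add_comm _ _
  | mul_comm => exact _root_.mul_comm _ _
  | _ => simp_all [eval, _root_.add_assoc, _root_.mul_assoc, _root_.mul_add,
      PoissonAlgebra.bracket_self, ← Algebra.smul_def]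

end

end PoissonTerm

/-! ### Presented Poisson algebras with operator. -/

/-- The Poisson algebra with a linear operator presented by the linear space of generators `C` and
the relations `R`. -/
def OpPoisson (k : Type*) [Field k] (C : Type*) [AddCommGroup C] [Module k C]
    (R : PoissonTerm k C → PoissonTerm k C → Prop) :=
  Quot (PoissonTerm.Rel R)

namespace OpPoisson

open PoissonTerm

section Algebra

variable {k : Type*} [Field k] {C : Type*} [AddCommGroup C] [Module k C]
  (R : PoissonTerm k C → PoissonTerm k C → Prop)

/-- The class of a term. -/
def mk (t : PoissonTerm k C) : OpPoisson k C R := Quot.mk _ t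

theorem mk_surjective : Function.Surjective (mk R) := Quot.mk_surjective

variable {R}

theorem mk_eq {a b : PoissonTerm k C} (h : Rel R a b) : mk R a = mk R b := Quot.sound h

instance : AddCommGroup (OpPoisson k C R) :=
  letI : Zero (OpPoisson k C R) := ⟨mk R (scalar 0)⟩
  letI : Add (OpPoisson k C R) :=
    ⟨Quot.map₂ add (fun c _ _ => .add_right c) fun _ _ c => .add_left c⟩
  letI : Neg (OpPoisson k C R) := ⟨Quot.map (mul (scalar (-1))) fun _ _ => .mul_right _⟩
  { add_assoc := by rintro ⟨a⟩ ⟨b⟩ ⟨c⟩; exact mk_eq (.add_assoc a b c)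
    zero_add := by rintro ⟨a⟩; exact mk_eq (.zero_add a)
    add_zero := by rintro ⟨a⟩; exact (mk_eq (.add_comm _ _)).trans (mk_eq (.zero_add a))
    add_comm := by rintro ⟨a⟩ ⟨b⟩; exact mk_eq (.add_comm a b)
    neg_add_cancel := by rintro ⟨a⟩; exact mk_eq (.neg_add_cancel a)
    nsmul := nsmulRec
    zsmul := zsmulRec }

instance : CommRing (OpPoisson k C R) where
  mul := Quot.map₂ mul (fun c _ _ => .mul_right c) fun _ _ c => .mul_left c
  one := mk R (scalar 1)
  mul_assoc := by rintro ⟨a⟩ ⟨b⟩ ⟨c⟩; exact mk_eq (.mul_assoc a b c)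
  mul_comm := by rintro ⟨a⟩ ⟨b⟩; exact mk_eq (.mul_comm a b)
  one_mul := by rintro ⟨a⟩; exact mk_eq (.one_mul a)
  mul_one := by rintro ⟨a⟩; exact (mk_eq (.mul_comm _ _)).trans (mk_eq (.one_mul a))
  left_distrib := by rintro ⟨a⟩ ⟨b⟩ ⟨c⟩; exact mk_eq (.mul_add a b c)
  right_distrib := by
    rintro ⟨a⟩ ⟨b⟩ ⟨c⟩
    exact (mk_eq (.mul_comm _ _)).trans <| (mk_eq (.mul_add c a b)).trans <|
      (mk_eq (.add_left _ (.mul_comm c a))).trans (mk_eq (.add_right _ (.mul_comm c b)))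
  zero_mul := by rintro ⟨a⟩; exact mk_eq (.zero_mul a)
  mul_zero := by rintro ⟨a⟩; exact (mk_eq (.mul_comm _ _)).trans (mk_eq (.zero_mul a))
  zsmul := zsmulRec
  neg_add_cancel := neg_add_cancel

instance : Algebra k (OpPoisson k C R) :=
  RingHom.toAlgebra
    { toFun := fun r => mk R (scalar r)
      map_zero' := rfl
      map_one' := rfl
      map_add' := fun r s => mk_eq (.scalar_add r s)
      map_mul' := fun r s => mk_eq (.scalar_mul r s) }

variable (R) in
/-- The inclusion of the generators. -/
def of : C →ₗ[k] OpPoisson k C R where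
  toFun c := mk R (.of c)
  map_add' c d := mk_eq (.of_add c d)
  map_smul' r c := mk_eq (.of_smul r c)

variable (R) in
/-- The linear operator. -/
def op : OpPoisson k C R →ₗ[k] OpPoisson k C R where
  toFun := Quot.map PoissonTerm.op fun _ _ => .op_congr
  map_add' := by rintro ⟨a⟩ ⟨b⟩; exact mk_eq (.op_add a b)
  map_smul' := by rintro r ⟨a⟩; exact mk_eq (.op_smul r a)

instance : PoissonAlgebra k (OpPoisson k C R) where
  bracket := LinearMap.mk₂ k
    (Quot.map₂ PoissonTerm.bracket (fun c _ _ => .bracket_right c) fun _ _ c => .bracket_left c)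
    (by rintro ⟨a⟩ ⟨b⟩ ⟨c⟩; exact mk_eq (.add_bracket a b c))
    (by rintro r ⟨a⟩ ⟨b⟩; exact mk_eq (.smul_bracket r a b))
    (by rintro ⟨a⟩ ⟨b⟩ ⟨c⟩; exact mk_eq (.bracket_add a b c))
    (by rintro r ⟨a⟩ ⟨b⟩; exact mk_eq (.bracket_smul r a b))
  bracket_self := by rintro ⟨a⟩; exact mk_eq (.bracket_self a)
  jacobi := by rintro ⟨a⟩ ⟨b⟩ ⟨c⟩; exact mk_eq (.jacobi a b c)
  leibniz := by rintro ⟨a⟩ ⟨b⟩ ⟨c⟩; exact mk_eq (.leibniz a b c)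

theorem induction {p : OpPoisson k C R → Prop} (of : ∀ c, p (of R c))
    (scalar : ∀ r, p (algebraMap k _ r)) (add : ∀ a b, p a → p b → p (a + b))
    (mul : ∀ a b, p a → p b → p (a * b))
    (bracket : ∀ a b, p a → p b → p (PoissonAlgebra.bracket (k := k) a b))
    (op : ∀ a, p a → p (op R a)) (a : OpPoisson k C R) : p a := by
  obtain ⟨t, rfl⟩ := mk_surjective R a
  induction t with
  | of c => exact of c
  | scalar r => exact scalar r
  | add a b ha hb => exact add _ _ ha hb
  | mul a b ha hb => exact mul _ _ ha hb
  | bracket a b ha hb => exact bracket _ _ ha hb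
  | op a ha => exact op _ ha

/-- Passing to classes is itself an evaluation, so projections between presented algebras can be
built with `lift` and computed on representatives. -/
theorem eval_op_of (R : PoissonTerm k C → PoissonTerm k C → Prop)
    (t : PoissonTerm k C) :
    eval (op R) (of R) t = mk R t := by
  induction t with
  | of c => rfl
  | scalar r => rfl
  | add a b ha hb => rw [PoissonTerm.eval, ha, hb]; rfl
  | mul a b ha hb => rw [PoissonTerm.eval, ha, hb]; rfl
  | bracket a b ha hb => rw [PoissonTerm.eval, ha, hb]; rfl
  | op a ha => rw [PoissonTerm.eval, ha]; rfl

variable {A : Type*} [CommRing A] [Algebra k A] [PoissonAlgebra k A]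

/-- The morphism to a Poisson algebra with operator `s` given by the images `f` of the
generators. -/
def lift (s : A →ₗ[k] A) (f : C →ₗ[k] A) (h : ∀ a b, R a b → eval s f a = eval s f b) :
    OpPoisson k C R →ₐ[k] A where
  toFun := Quot.lift (eval s f) fun _ _ => eval_eq_of_rel s f h
  map_one' := map_one (algebraMap k A)
  map_zero' := map_zero (algebraMap k A)
  map_mul' := by rintro ⟨a⟩ ⟨b⟩; rfl
  map_add' := by rintro ⟨a⟩ ⟨b⟩; rfl
  commutes' _ := rfl

section lift

variable (s : A →ₗ[k] A) (f : C →ₗ[k] A) (h : ∀ a b, R a b → eval s f a = eval s f b)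

theorem lift_op (a : OpPoisson k C R) : lift s f h (op R a) = s (lift s f h a) := by
  obtain ⟨a, rfl⟩ := mk_surjective R a
  rfl

theorem preservesBracket_lift : PreservesBracket (lift s f h).toLinearMap := by
  rintro ⟨a⟩ ⟨b⟩
  rfl

end lift

/-- Two bracket preserving algebra maps are equal if they agree on the generators, and on `op a`
whenever they agree on `a`. -/
theorem algHom_ext {φ ψ : OpPoisson k C R →ₐ[k] A}
    (hφ : PreservesBracket φ.toLinearMap) (hψ : PreservesBracket ψ.toLinearMap)
    (hop : ∀ a, φ a = ψ a → φ (op R a) = ψ (op R a)) (h : ∀ c, φ (of R c) = ψ (of R c)) :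
    φ = ψ := by
  ext a
  induction a using induction with
  | of c => exact h c
  | scalar r => simp
  | add a b ha hb => simp [ha, hb]
  | mul a b ha hb => simp [ha, hb]
  | bracket a b ha hb => exact (hφ a b).trans (by simp [ha, hb]; exact (hψ a b).symm)
  | op a ha => exact hop a ha

end Algebra

end OpPoisson

/-! ### Bracket-preserving maps and tensor products. -/

namespace PreservesBracket

variable {k : Type*} [Field k] {A B A' B' : Type*} [CommRing A] [Algebra k A] [PoissonAlgebra k A]
  [CommRing B] [Algebra k B] [PoissonAlgebra k B] [CommRing A'] [Algebra k A']
  [PoissonAlgebra k A'] [CommRing B'] [Algebra k B'] [PoissonAlgebra k B']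

theorem comp {g : B →ₗ[k] A'} {f : A →ₗ[k] B} (hg : PreservesBracket g)
    (hf : PreservesBracket f) : PreservesBracket (g ∘ₗ f) := fun a b =>
  (congrArg g (hf a b)).trans (hg _ _)

protected theorem id : PreservesBracket (AlgHom.id k A).toLinearMap := fun _ _ => rfl

theorem tensor_ext {f : A ⊗[k] B →ₗ[k] A'}
    (h : ∀ a a' b b', f (PoissonAlgebra.tensorBracket k A B (a ⊗ₜ b) (a' ⊗ₜ b')) =
      PoissonAlgebra.bracket (k := k) (f (a ⊗ₜ b)) (f (a' ⊗ₜ b'))) :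
    PreservesBracket f := by
  have : (PoissonAlgebra.tensorBracket k A B).compr₂ f =
      (PoissonAlgebra.bracket (k := k) (A := A')).compl₁₂ f f := by
    ext a b a' b'
    exact h a a' b b'
  exact fun x y => LinearMap.congr_fun₂ this x y

theorem tensorMap {f : A →ₐ[k] A'} {g : B →ₐ[k] B'} (hf : PreservesBracket f.toLinearMap)
    (hg : PreservesBracket g.toLinearMap) :
    PreservesBracket (Algebra.TensorProduct.map f g).toLinearMap := by
  refine tensor_ext fun a a' b b' => ?_
  have hf' : f _ = _ := hf a a'
  have hg' : g _ = _ := hg b b'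
  change _ = PoissonAlgebra.tensorBracket k A' B' _ _
  simp [PoissonAlgebra.tensorBracket_tmul, hf', hg']

/-- The extra term of the tensor bracket contains `[1, 1] = 0`. -/
theorem includeRight :
    PreservesBracket (Algebra.TensorProduct.includeRight : B →ₐ[k] A ⊗[k] B).toLinearMap :=
  fun a b => by
    change _ = PoissonAlgebra.tensorBracket k A B _ _
    simp [PoissonAlgebra.tensorBracket_tmul, PoissonAlgebra.bracket_self]

theorem includeLeft :
    PreservesBracket (Algebra.TensorProduct.includeLeft : A →ₐ[k] A ⊗[k] B).toLinearMap :=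
  fun a b => by
    change _ = PoissonAlgebra.tensorBracket k A B _ _
    simp [PoissonAlgebra.tensorBracket_tmul, PoissonAlgebra.bracket_self]

/-- On pure tensors both bracketings expand to the same three terms, one for each factor that
carries the bracket. -/
theorem assoc : PreservesBracket
    (Algebra.TensorProduct.assoc k k k A B A').toAlgHom.toLinearMap := by
  intro x z
  induction x using TensorProduct.induction_on with
  | zero => simp
  | add x y hx hy => simp_all
  | tmul x c =>
  induction z using TensorProduct.induction_on with
  | zero => simp
  | add x y hx hy => simp_all
  | tmul z c' =>
  induction x using TensorProduct.induction_on with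
  | zero => simp
  | add x y hx hy => simp_all [TensorProduct.add_tmul]
  | tmul a b =>
  induction z using TensorProduct.induction_on with
  | zero => simp
  | add x y hx hy => simp_all [TensorProduct.add_tmul]
  | tmul a' b' =>
  change _ = PoissonAlgebra.tensorBracket k A (B ⊗[k] A') (a ⊗ₜ (b ⊗ₜ c)) (a' ⊗ₜ (b' ⊗ₜ c'))
  change (Algebra.TensorProduct.assoc k k k A B A')
    (PoissonAlgebra.tensorBracket k (A ⊗[k] B) A' ((a ⊗ₜ b) ⊗ₜ c) ((a' ⊗ₜ b') ⊗ₜ c')) = _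
  rw [PoissonAlgebra.tensorBracket_tmul, PoissonAlgebra.tensorBracket_tmul]
  change (Algebra.TensorProduct.assoc k k k A B A')
    (_ + PoissonAlgebra.tensorBracket k A B _ _ ⊗ₜ _) =
      _ ⊗ₜ PoissonAlgebra.tensorBracket k B A' _ _ + _
  rw [PoissonAlgebra.tensorBracket_tmul, PoissonAlgebra.tensorBracket_tmul]
  simp [TensorProduct.add_tmul, TensorProduct.tmul_add, _root_.add_assoc]

end PreservesBracket

/-! ### The bialgebra structure on a presented algebra. -/

/-- The linear map `a ⊗ b ↦ s b ⊗ s a`. -/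
noncomputable def TensorProduct.twist {k A : Type*} [Field k] [CommRing A] [Algebra k A]
    (s : A →ₗ[k] A) : A ⊗[k] A →ₗ[k] A ⊗[k] A :=
  (TensorProduct.comm k A A).toLinearMap ∘ₗ TensorProduct.map s s

@[simp]
theorem TensorProduct.twist_tmul {k A : Type*} [Field k] [CommRing A] [Algebra k A]
    (s : A →ₗ[k] A) (a b : A) : TensorProduct.twist s (a ⊗ₜ b) = s b ⊗ₜ s a := rfl

namespace OpPoisson

open PoissonTerm TensorProduct

section Bialgebra

variable {k : Type*} [Field k] {C : Type*} [AddCommGroup C] [Module k C] [Coalgebra k C]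
  (R : PoissonTerm k C → PoissonTerm k C → Prop)

/-- The comultiplication on generators. -/
noncomputable def comulGen : C →ₗ[k] OpPoisson k C R ⊗[k] OpPoisson k C R :=
  TensorProduct.map (of R) (of R) ∘ₗ Coalgebra.comul

/-- The relations `R` are respected by the comultiplication and the counit. -/
class IsCoalgebraic : Prop where
  comul : ∀ a b, R a b →
    eval (twist (op R)) (comulGen R) a = eval (twist (op R)) (comulGen R) b
  counit : ∀ a b, R a b → eval (LinearMap.id (R := k) (M := k)) Coalgebra.counit a =
    eval (LinearMap.id (R := k) (M := k)) Coalgebra.counit b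

variable [IsCoalgebraic R]

/-- The comultiplication. -/
noncomputable def comulHom : OpPoisson k C R →ₐ[k] OpPoisson k C R ⊗[k] OpPoisson k C R :=
  lift (twist (op R)) (comulGen R) IsCoalgebraic.comul

/-- The counit. -/
noncomputable def counitHom : OpPoisson k C R →ₐ[k] k :=
  lift LinearMap.id Coalgebra.counit IsCoalgebraic.counit

theorem comulHom_op (a : OpPoisson k C R) : comulHom R (op R a) = twist (op R) (comulHom R a) :=
  lift_op _ _ _ a

theorem counitHom_op (a : OpPoisson k C R) : counitHom R (op R a) = counitHom R a :=
  lift_op _ _ _ a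

theorem preservesBracket_comulHom : PreservesBracket (comulHom R).toLinearMap :=
  preservesBracket_lift _ _ _

theorem preservesBracket_counitHom : PreservesBracket (counitHom R).toLinearMap :=
  preservesBracket_lift _ _ _

/-- On generators this is coassociativity of `C`. On `op a`, the reversal of factors exchanges the
two sides: each side at `op a` is the order-reversing triple operator applied to the other side at
`a`. Hence equality at `a` gives equality at `op a`. -/
theorem comulHom_coassoc :
    (Algebra.TensorProduct.assoc k k k _ _ _).toAlgHom.comp
      ((Algebra.TensorProduct.map (comulHom R) (.id k _)).comp (comulHom R)) =
    (Algebra.TensorProduct.map (.id k _) (comulHom R)).comp (comulHom R) := by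
  have hΔ := preservesBracket_comulHom R
  refine algHom_ext (.comp .assoc (.comp (.tensorMap hΔ .id) hΔ)) (.comp (.tensorMap .id hΔ) hΔ)
    (fun a ha => ?_) fun c => ?_
  · let P := OpPoisson k C R
    let t := twist (op R)
    have h₁ : (TensorProduct.assoc k P P P).toLinearMap ∘ₗ
        TensorProduct.map (comulHom R).toLinearMap LinearMap.id ∘ₗ t =
        ((TensorProduct.assoc k P P P).toLinearMap ∘ₗ
          (TensorProduct.comm k P (P ⊗[k] P)).toLinearMap ∘ₗ TensorProduct.map (op R) t) ∘ₗ
          TensorProduct.map LinearMap.id (comulHom R).toLinearMap := by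
      ext a b
      simp [t, comulHom_op]
    have h₂ : TensorProduct.map LinearMap.id (comulHom R).toLinearMap ∘ₗ t =
        ((TensorProduct.comm k (P ⊗[k] P) P).toLinearMap ∘ₗ TensorProduct.map t (op R)) ∘ₗ
          TensorProduct.map (comulHom R).toLinearMap LinearMap.id := by
      ext a b
      simp [t, comulHom_op]
    -- The operators found in `h₁` and `h₂` are both `a ⊗ b ⊗ c ↦ op c ⊗ op b ⊗ op a`, up to
    -- reassociating the source.
    have h₃ : ((TensorProduct.assoc k P P P).toLinearMap ∘ₗ
          (TensorProduct.comm k P (P ⊗[k] P)).toLinearMap ∘ₗ TensorProduct.map (op R) t) ∘ₗ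
          (TensorProduct.assoc k P P P).toLinearMap =
        (TensorProduct.comm k (P ⊗[k] P) P).toLinearMap ∘ₗ TensorProduct.map t (op R) := by
      ext a b c
      simp [t]
    have e₁ := LinearMap.congr_fun h₁ (comulHom R a)
    have e₂ := LinearMap.congr_fun h₂ (comulHom R a)
    have e₃ := LinearMap.congr_fun h₃
      (TensorProduct.map (comulHom R).toLinearMap LinearMap.id (comulHom R a))
    have ha' : TensorProduct.assoc k P P P
      (TensorProduct.map (comulHom R).toLinearMap LinearMap.id (comulHom R a)) =
      TensorProduct.map LinearMap.id (comulHom R).toLinearMap (comulHom R a) := ha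
    change TensorProduct.assoc k P P P
      (TensorProduct.map (comulHom R).toLinearMap LinearMap.id (comulHom R (op R a))) =
      TensorProduct.map LinearMap.id (comulHom R).toLinearMap (comulHom R (op R a))
    rw [comulHom_op]
    refine e₁.trans (.trans ?_ e₂.symm)
    refine .trans ?_ e₃
    exact congrArg ((TensorProduct.assoc k P P P).toLinearMap ∘ₗ
      (TensorProduct.comm k P (P ⊗[k] P)).toLinearMap ∘ₗ TensorProduct.map (op R) t) ha'.symm
  · have h₁ : (comulHom R).toLinearMap ∘ₗ of R =
      TensorProduct.map (of R) (of R) ∘ₗ Coalgebra.comul := rfl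
    have h := congrArg (TensorProduct.map (of R) (TensorProduct.map (of R) (of R)))
      (Coalgebra.coassoc_apply (R := k) c)
    change TensorProduct.assoc k _ _ _
      (TensorProduct.map (comulHom R).toLinearMap LinearMap.id
        (TensorProduct.map (of R) (of R) (Coalgebra.comul c))) =
      TensorProduct.map LinearMap.id (comulHom R).toLinearMap
        (TensorProduct.map (of R) (of R) (Coalgebra.comul c))
    rw [TensorProduct.map_map, TensorProduct.map_map, h₁, LinearMap.id_comp]
    refine .trans (.trans ?_ h) ?_
    · rw [TensorProduct.map_map_assoc, LinearMap.rTensor, TensorProduct.map_map, LinearMap.comp_id]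
    · rw [LinearMap.lTensor, TensorProduct.map_map, LinearMap.comp_id]

/-- The two counit laws need a simultaneous induction, because `op` reverses the tensor factors and
each law at `op a` follows from the other one at `a`. -/
theorem counitHom_comulHom :
    (Algebra.TensorProduct.map (counitHom R) (.id k _)).comp (comulHom R) =
        (Algebra.TensorProduct.lid k (OpPoisson k C R)).symm ∧
      (Algebra.TensorProduct.map (.id k _) (counitHom R)).comp (comulHom R) =
        (Algebra.TensorProduct.rid k k (OpPoisson k C R)).symm := by
  set P := OpPoisson k C R
  have h₁ : TensorProduct.map (counitHom R).toLinearMap LinearMap.id ∘ₗ twist (op R) =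
      ((TensorProduct.comm k P k).toLinearMap ∘ₗ TensorProduct.map (op R) LinearMap.id) ∘ₗ
        TensorProduct.map LinearMap.id (counitHom R).toLinearMap := by
    ext a b
    simp [counitHom_op]
  have h₂ : TensorProduct.map LinearMap.id (counitHom R).toLinearMap ∘ₗ twist (op R) =
      ((TensorProduct.comm k k P).toLinearMap ∘ₗ TensorProduct.map LinearMap.id (op R)) ∘ₗ
        TensorProduct.map (counitHom R).toLinearMap LinearMap.id := by
    ext a b
    simp [counitHom_op]
  have hΔ := preservesBracket_comulHom R
  have hε := preservesBracket_counitHom R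
  have key : ∀ a : P,
      TensorProduct.map (counitHom R).toLinearMap LinearMap.id (comulHom R a) = 1 ⊗ₜ a ∧
      TensorProduct.map LinearMap.id (counitHom R).toLinearMap (comulHom R a) = a ⊗ₜ 1 := by
    intro a
    -- Reading `1 ⊗ a` and `a ⊗ 1` as values of bracket-preserving algebra maps settles the scalar,
    -- sum, product and bracket cases.
    change (Algebra.TensorProduct.map (counitHom R) (.id k P)) (comulHom R a) =
        (Algebra.TensorProduct.includeRight : P →ₐ[k] k ⊗[k] P) a ∧
      (Algebra.TensorProduct.map (.id k P) (counitHom R)) (comulHom R a) =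
        (Algebra.TensorProduct.includeLeft : P →ₐ[k] P ⊗[k] k) a
    induction a using induction with
    | of c =>
      have e₁ := congrArg (TensorProduct.map LinearMap.id (of R))
        (Coalgebra.rTensor_counit_comul (R := k) c)
      have e₂ := congrArg (TensorProduct.map (of R) LinearMap.id)
        (Coalgebra.lTensor_counit_comul (R := k) c)
      rw [LinearMap.rTensor, TensorProduct.map_map] at e₁
      rw [LinearMap.lTensor, TensorProduct.map_map] at e₂
      constructor
      · exact (TensorProduct.map_map _ _ _ _ _).trans e₁
      · exact (TensorProduct.map_map _ _ _ _ _).trans e₂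
    | scalar r =>
      rw [AlgHom.commutes (comulHom R)]
      exact ⟨(AlgHom.commutes _ _).trans (AlgHom.commutes _ _).symm,
        (AlgHom.commutes _ _).trans (AlgHom.commutes _ _).symm⟩
    | add a b ha hb => simp only [map_add, ha, hb, and_self]
    | mul a b ha hb => simp only [map_mul, ha, hb, and_self]
    | bracket a b ha hb =>
      have e₁ := PreservesBracket.comp (.tensorMap hε .id) hΔ a b
      have e₂ := PreservesBracket.comp (.tensorMap .id hε) hΔ a b
      constructor
      · refine e₁.trans (.trans ?_ (PreservesBracket.includeRight (k := k) a b).symm)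
        exact congrArg₂ (fun x y => PoissonAlgebra.bracket (k := k) x y) ha.1 hb.1
      · refine e₂.trans (.trans ?_ (PreservesBracket.includeLeft (k := k) a b).symm)
        exact congrArg₂ (fun x y => PoissonAlgebra.bracket (k := k) x y) ha.2 hb.2
    | op a ha =>
      rw [comulHom_op]
      constructor
      · exact (LinearMap.congr_fun h₁ (comulHom R a)).trans (congrArg ((TensorProduct.comm k P
          k).toLinearMap ∘ₗ TensorProduct.map (op R) LinearMap.id) ha.2)
      · exact (LinearMap.congr_fun h₂ (comulHom R a)).trans (congrArg ((TensorProduct.comm k k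
          P).toLinearMap ∘ₗ TensorProduct.map LinearMap.id (op R)) ha.1)
  exact ⟨AlgHom.ext fun a => (key a).1, AlgHom.ext fun a => (key a).2⟩

noncomputable instance : Bialgebra k (OpPoisson k C R) :=
  .ofAlgHom (comulHom R) (counitHom R) (comulHom_coassoc R) (counitHom_comulHom R).1
    (counitHom_comulHom R).2

instance : IsPoissonBialgebra k (OpPoisson k C R) where
  comul_bracket := preservesBracket_comulHom R
  counit_bracket := preservesBracket_counitHom R

end Bialgebra
end OpPoisson

/-! ### Convolution inverses and antipodes. -/

section Convolution

open WithConv TensorProduct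

variable {k : Type*} [Field k]

/-- Comes from `a ⊗ b = (a ⊗ 1)(1 ⊗ b)`; it reduces inverses in the tensor product to inverses in
each factor. -/
theorem LinearMap.toConv_map_comp_comul {P A B : Type*} [AddCommGroup P] [Module k P]
    [Coalgebra k P] [CommRing A] [Algebra k A] [CommRing B] [Algebra k B] (q : P →ₗ[k] A)
    (r : P →ₗ[k] B) :
    toConv (TensorProduct.map q r ∘ₗ Coalgebra.comul) =
      toConv (Algebra.TensorProduct.includeLeft.toLinearMap ∘ₗ q : P →ₗ[k] A ⊗[k] B) *
        toConv (Algebra.TensorProduct.includeRight.toLinearMap ∘ₗ r : P →ₗ[k] A ⊗[k] B) := by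
  rw [LinearMap.convMul_def, ← LinearMap.comp_assoc]
  congr 2
  ext
  simp

theorem LinearMap.toConv_comm_map_comp_comul {P A B : Type*} [AddCommGroup P] [Module k P]
    [Coalgebra k P] [CommRing A] [Algebra k A] [CommRing B] [Algebra k B] (q : P →ₗ[k] A)
    (r : P →ₗ[k] B) :
    toConv ((TensorProduct.comm k A B).toLinearMap ∘ₗ TensorProduct.map q r ∘ₗ Coalgebra.comul) =
      toConv (Algebra.TensorProduct.includeRight.toLinearMap ∘ₗ q : P →ₗ[k] B ⊗[k] A) *
        toConv (Algebra.TensorProduct.includeLeft.toLinearMap ∘ₗ r : P →ₗ[k] B ⊗[k] A) := by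
  rw [LinearMap.convMul_def, ← LinearMap.comp_assoc, ← LinearMap.comp_assoc]
  congr 2
  ext
  simp

theorem AlgHom.toConv_comp_mul_toConv_comp {P A B : Type*} [AddCommGroup P] [Module k P]
    [Coalgebra k P] [CommRing A] [Algebra k A] [CommRing B] [Algebra k B] (h : A →ₐ[k] B)
    {q r : P →ₗ[k] A} (hqr : toConv q * toConv r = 1) :
    toConv (h.toLinearMap ∘ₗ q) * toConv (h.toLinearMap ∘ₗ r) = 1 := by
  have := congrArg toConv (LinearMap.algHom_comp_convMul_distrib h (toConv q) (toConv r))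
  rw [hqr] at this
  refine this.symm.trans ?_
  ext x
  simp [LinearMap.convOne_def]

/-- The inverse of a convolution product is the product of the inverses in reverse order, and the
flip supplies that reversal. The inner pair cancels first, then the outer one. -/
theorem LinearMap.toConv_comm_map_comul_mul_toConv_map_comul {P A : Type*} [AddCommGroup P]
    [Module k P] [Coalgebra k P] [CommRing A] [Algebra k A] {q r : P →ₗ[k] A}
    (h : toConv r * toConv q = 1) :
    toConv ((TensorProduct.comm k A A).toLinearMap ∘ₗ TensorProduct.map r r ∘ₗ Coalgebra.comul) *
      toConv (TensorProduct.map q q ∘ₗ Coalgebra.comul) = 1 := by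
  rw [toConv_comm_map_comp_comul, toConv_map_comp_comul, mul_assoc,
    ← mul_assoc _ _ (toConv (_ ∘ₗ q)),
    AlgHom.toConv_comp_mul_toConv_comp _ h, one_mul, AlgHom.toConv_comp_mul_toConv_comp _ h]

theorem LinearMap.toConv_map_comul_mul_toConv_comm_map_comul {P A : Type*} [AddCommGroup P]
    [Module k P] [Coalgebra k P] [CommRing A] [Algebra k A] {q r : P →ₗ[k] A}
    (h : toConv q * toConv r = 1) :
    toConv (TensorProduct.map q q ∘ₗ Coalgebra.comul) *
      toConv ((TensorProduct.comm k A A).toLinearMap ∘ₗ TensorProduct.map r r ∘ₗ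
        Coalgebra.comul) = 1 := by
  rw [toConv_comm_map_comp_comul, toConv_map_comp_comul, mul_assoc,
    ← mul_assoc _ _ (toConv (_ ∘ₗ r)),
    AlgHom.toConv_comp_mul_toConv_comp _ h, one_mul, AlgHom.toConv_comp_mul_toConv_comp _ h]

/-- The antipode reverses the comultiplication. -/
theorem HopfAlgebra.comul_antipode {A : Type*} [CommRing A] [HopfAlgebra k A] (a : A) :
    Coalgebra.comul (R := k) (antipode k a) = twist (antipode k) (Coalgebra.comul a) := by
  -- Both sides are convolution inverses of `Δ`: `Δ ∘ S` a left inverse, the twisted map a right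
  -- inverse.
  have h₁ := AlgHom.toConv_comp_mul_toConv_comp (Bialgebra.comulAlgHom k A)
    (LinearMap.antipode_mul_id (R := k) (C := A))
  have h₂ := LinearMap.toConv_map_comul_mul_toConv_comm_map_comul
    (LinearMap.id_mul_antipode (R := k) (C := A))
  rw [TensorProduct.map_id] at h₂
  exact LinearMap.congr_fun (congrArg ofConv (left_inv_eq_right_inv h₁ h₂)) a

/-- Bialgebra maps between Hopf algebras commute with the antipodes. -/
theorem BialgHom.map_antipode {A B : Type*} [CommRing A] [HopfAlgebra k A] [CommRing B]
    [HopfAlgebra k B] (f : A →ₐc[k] B) (a : A) :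
    f (HopfAlgebra.antipode k a) = HopfAlgebra.antipode k (f a) := by
  -- `f ∘ S` is a left and `S ∘ f` a right convolution inverse of `f`.
  have h₁ := AlgHom.toConv_comp_mul_toConv_comp (f : A →ₐ[k] B)
    (LinearMap.antipode_mul_id (R := k) (C := A))
  have h₂ := congrArg toConv (LinearMap.convMul_comp_coalgHom_distrib (toConv LinearMap.id)
    (toConv (HopfAlgebra.antipode k (A := B))) (f : A →ₗc[k] B))
  rw [LinearMap.id_mul_antipode] at h₂
  have h₃ : toConv ((1 : WithConv (B →ₗ[k] B)).ofConv ∘ₗ (f : A →ₗc[k] B).toLinearMap) = 1 := by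
    ext x
    simp [LinearMap.convOne_def]
  exact LinearMap.congr_fun (congrArg ofConv (left_inv_eq_right_inv h₁ (h₂.symm.trans h₃))) a

end Convolution

/-! ### Bialgebra maps out of a presented algebra. -/

namespace OpPoisson

open PoissonTerm TensorProduct WithConv

variable {k : Type*} [Field k] {C : Type*} [AddCommGroup C] [Module k C] [Coalgebra k C]

section liftBialgHom

variable {R : PoissonTerm k C → PoissonTerm k C → Prop} [IsCoalgebraic R]

theorem comul_op (a : OpPoisson k C R) :
    Coalgebra.comul (R := k) (op R a) = twist (op R) (Coalgebra.comul a) := comulHom_op R a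

theorem counit_op (a : OpPoisson k C R) :
    Coalgebra.counit (R := k) (op R a) = Coalgebra.counit (R := k) a := counitHom_op R a

variable (R) in
/-- The inclusion of the generators as a map of coalgebras. -/
noncomputable def ofCoalgHom : C →ₗc[k] OpPoisson k C R where
  __ := of R
  counit_comp := rfl
  map_comp_comul := rfl

variable {A : Type*} [CommRing A] [Bialgebra k A] [PoissonAlgebra k A] [IsPoissonBialgebra k A]

/-- `OpPoisson.lift` is a map of bialgebras if the operator reverses the comultiplication. -/
noncomputable def liftBialgHom (s : A →ₗ[k] A) (f : C →ₗc[k] A)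
    (hcomul : ∀ a, Coalgebra.comul (R := k) (s a) = twist s (Coalgebra.comul a))
    (hcounit : ∀ a, Coalgebra.counit (R := k) (s a) = Coalgebra.counit (R := k) a)
    (h : ∀ a b, R a b → eval s f.toLinearMap a = eval s f.toLinearMap b) :
    OpPoisson k C R →ₐc[k] A :=
  .ofAlgHom (lift s f.toLinearMap h)
    (by
      refine algHom_ext (.comp IsPoissonBialgebra.counit_bracket (preservesBracket_lift _ _ _))
        IsPoissonBialgebra.counit_bracket (fun a ha => ?_) fun c => ?_
      · change Coalgebra.counit (R := k) (lift s f.toLinearMap h (op R a)) =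
          Coalgebra.counit (R := k) (op R a)
        rw [lift_op, hcounit, counit_op]
        exact ha
      · exact CoalgHomClass.counit_comp_apply f c)
    (by
      have hl := preservesBracket_lift s f.toLinearMap h
      have hc : PreservesBracket (Bialgebra.comulAlgHom k (OpPoisson k C R)).toLinearMap :=
        IsPoissonBialgebra.comul_bracket
      refine algHom_ext (.comp (.tensorMap hl hl) hc) (.comp IsPoissonBialgebra.comul_bracket hl)
        (fun a ha => ?_) fun c => ?_
      · change TensorProduct.map (lift s f.toLinearMap h).toLinearMap
          (lift s f.toLinearMap h).toLinearMap (Coalgebra.comul (R := k) (op R a)) =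
          Coalgebra.comul (R := k) (lift s f.toLinearMap h (op R a))
        replace ha : TensorProduct.map (lift s f.toLinearMap h).toLinearMap
          (lift s f.toLinearMap h).toLinearMap (Coalgebra.comul (R := k) a) =
          Coalgebra.comul (R := k) (lift s f.toLinearMap h a) := ha
        -- The tensor square of the lift intertwines the twisted operators, which carries the
        -- equality from `a` to `op a`.
        have e : TensorProduct.map (lift s f.toLinearMap h).toLinearMap
            (lift s f.toLinearMap h).toLinearMap ∘ₗ twist (op R) =
            twist s ∘ₗ TensorProduct.map (lift s f.toLinearMap h).toLinearMap
              (lift s f.toLinearMap h).toLinearMap := by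
          ext
          simp [lift_op]
        rw [lift_op, hcomul, comul_op, ← ha]
        exact LinearMap.congr_fun e _
      · exact (TensorProduct.map_map _ _ _ _ _).trans (CoalgHomClass.map_comp_comul_apply f c))

end liftBialgHom

/-! ### The antipode relations. -/

instance : IsCoalgebraic (⊥ : PoissonTerm k C → PoissonTerm k C → Prop) where
  comul _ _ := False.elim
  counit _ _ := False.elim

variable (k C) in
/-- The free Poisson algebra with a linear operator on `C`. -/
abbrev FreeOpPoisson := OpPoisson k C (⊥ : PoissonTerm k C → PoissonTerm k C → Prop)

/-- The relations saying that the operator is an antipode. -/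
def AntipodeRel (a b : PoissonTerm k C) : Prop :=
  ∃ x : FreeOpPoisson k C,
    mk ⊥ b = (1 : WithConv (FreeOpPoisson k C →ₗ[k] FreeOpPoisson k C)) x ∧
      (mk ⊥ a = (toConv (op ⊥) * toConv LinearMap.id :
        WithConv (FreeOpPoisson k C →ₗ[k] FreeOpPoisson k C)) x ∨
        mk ⊥ a = (toConv LinearMap.id * toConv (op ⊥) :
        WithConv (FreeOpPoisson k C →ₗ[k] FreeOpPoisson k C)) x)

/-- Algebra maps distribute over convolution and `φ` carries `op` to `s`, so the relation at `x`
becomes the assumed inverse identity at `x`. Taking `φ` up to an equation allows a convenient form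
of the evaluation; the lemma serves for the tensor square, for `k` and for a target Hopf algebra. -/
theorem eval_eq_of_antipodeRel {A : Type*} [CommRing A] [Algebra k A] [PoissonAlgebra k A]
    (s : A →ₗ[k] A) (f : C →ₗ[k] A) (φ : FreeOpPoisson k C →ₐ[k] A)
    (hφ : φ = lift s f fun _ _ => False.elim)
    (h₁ : toConv (s ∘ₗ φ.toLinearMap) * toConv φ.toLinearMap = 1)
    (h₂ : toConv φ.toLinearMap * toConv (s ∘ₗ φ.toLinearMap) = 1)
    (a b : PoissonTerm k C) (hab : AntipodeRel a b) : eval s f a = eval s f b := by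
  obtain ⟨x, hb, ha⟩ := hab
  have hs : s ∘ₗ φ.toLinearMap = φ.toLinearMap ∘ₗ op ⊥ := by
    subst hφ
    ext y
    exact (lift_op s f (fun _ _ => False.elim) y).symm
  rw [hs] at h₁ h₂
  have e₁ := LinearMap.algHom_comp_convMul_distrib φ (toConv (op ⊥))
    (toConv (LinearMap.id (R := k) (M := FreeOpPoisson k C)))
  have e₂ := LinearMap.algHom_comp_convMul_distrib φ
    (toConv (LinearMap.id (R := k) (M := FreeOpPoisson k C))) (toConv (op ⊥))
  have e₃ : φ (mk ⊥ b) = algebraMap k A (Coalgebra.counit x) := by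
    rw [hb]
    simp
  have key : φ (mk ⊥ a) = φ (mk ⊥ b) := by
    rw [e₃]
    rcases ha with ha | ha
    · rw [ha]
      exact (LinearMap.congr_fun e₁ x).trans (LinearMap.congr_fun (congrArg ofConv h₁) x)
    · rw [ha]
      exact (LinearMap.congr_fun e₂ x).trans (LinearMap.congr_fun (congrArg ofConv h₂) x)
  subst hφ
  exact key

end OpPoisson

/-! ### The free Poisson Hopf algebra. -/

namespace OpPoisson

open PoissonTerm TensorProduct WithConv

variable (k : Type*) [Field k] (C : Type*) [AddCommGroup C] [Module k C] [Coalgebra k C]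

/-- The free Poisson Hopf algebra on the coalgebra `C`. -/
abbrev FreePoissonHopf := OpPoisson k C AntipodeRel

variable {k C}

variable (k C) in
/-- The projection to the free Poisson Hopf algebra. -/
def toFreePoissonHopf : FreeOpPoisson k C →ₐ[k] FreePoissonHopf k C :=
  lift (op _) (of _) fun _ _ => False.elim

theorem toFreePoissonHopf_mk (t : PoissonTerm k C) :
    toFreePoissonHopf k C (mk ⊥ t) = mk AntipodeRel t := eval_op_of _ t

theorem toFreePoissonHopf_surjective : Function.Surjective (toFreePoissonHopf k C) := fun a => by
  obtain ⟨t, rfl⟩ := mk_surjective _ a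
  exact ⟨mk _ t, toFreePoissonHopf_mk t⟩

theorem toFreePoissonHopf_op (a : FreeOpPoisson k C) :
    toFreePoissonHopf k C (op ⊥ a) = op AntipodeRel (toFreePoissonHopf k C a) :=
  lift_op _ _ (fun _ _ => False.elim) a

theorem op_comp_toFreePoissonHopf :
    op AntipodeRel ∘ₗ (toFreePoissonHopf k C).toLinearMap =
      (toFreePoissonHopf k C).toLinearMap ∘ₗ op ⊥ :=
  LinearMap.ext fun a => (toFreePoissonHopf_op a).symm

/-- These are the imposed relations, read as an identity of maps out of the free algebra: the
quotient has no coalgebra structure at this point, so convolution on it is not yet available. -/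
theorem toConv_op_comp_mul_toConv :
    toConv (op AntipodeRel ∘ₗ (toFreePoissonHopf k C).toLinearMap) *
      toConv (toFreePoissonHopf k C).toLinearMap = 1 := by
  rw [op_comp_toFreePoissonHopf]
  have e := LinearMap.algHom_comp_convMul_distrib (toFreePoissonHopf k C) (toConv (op ⊥))
    (toConv (LinearMap.id (R := k) (M := FreeOpPoisson k C)))
  refine WithConv.ext (e.symm.trans (LinearMap.ext fun x => ?_))
  obtain ⟨a, ha⟩ := mk_surjective _ ((toConv (op ⊥) * toConv LinearMap.id :
    WithConv (FreeOpPoisson k C →ₗ[k] FreeOpPoisson k C)) x)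
  have h : mk AntipodeRel a = mk AntipodeRel (scalar (Coalgebra.counit x)) :=
    mk_eq (.rel ⟨x, rfl, .inl ha⟩)
  exact (congrArg (toFreePoissonHopf k C) ha.symm).trans ((toFreePoissonHopf_mk a).trans h)

theorem toConv_mul_toConv_op_comp :
    toConv (toFreePoissonHopf k C).toLinearMap *
      toConv (op AntipodeRel ∘ₗ (toFreePoissonHopf k C).toLinearMap) = 1 := by
  rw [op_comp_toFreePoissonHopf]
  have e := LinearMap.algHom_comp_convMul_distrib (toFreePoissonHopf k C)
    (toConv (LinearMap.id (R := k) (M := FreeOpPoisson k C))) (toConv (op ⊥))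
  refine WithConv.ext (e.symm.trans (LinearMap.ext fun x => ?_))
  obtain ⟨a, ha⟩ := mk_surjective _ ((toConv LinearMap.id * toConv (op ⊥) :
    WithConv (FreeOpPoisson k C →ₗ[k] FreeOpPoisson k C)) x)
  have h : mk AntipodeRel a = mk AntipodeRel (scalar (Coalgebra.counit x)) :=
    mk_eq (.rel ⟨x, rfl, .inr ha⟩)
  exact (congrArg (toFreePoissonHopf k C) ha.symm).trans ((toFreePoissonHopf_mk a).trans h)

theorem twist_comp_map_comp_comul {A : Type*} [CommRing A] [Algebra k A] (s : A →ₗ[k] A)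
    {P : Type*} [AddCommGroup P] [Module k P] [Coalgebra k P] (q : P →ₗ[k] A) :
    twist s ∘ₗ TensorProduct.map q q ∘ₗ Coalgebra.comul =
      (TensorProduct.comm k A A).toLinearMap ∘ₗ TensorProduct.map (s ∘ₗ q) (s ∘ₗ q) ∘ₗ
        Coalgebra.comul := by
  rw [TensorProduct.map_comp]
  rfl

/-- Identifies the evaluation that must respect the antipode relations with `(q ⊗ q) ∘ Δ`, whose
convolution inverse is computable. -/
theorem map_comp_comulAlgHom_eq_lift :
    (Algebra.TensorProduct.map (toFreePoissonHopf k C) (toFreePoissonHopf k C)).comp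
      (Bialgebra.comulAlgHom k (FreeOpPoisson k C)) =
    lift (twist (op AntipodeRel)) (comulGen AntipodeRel) fun _ _ => False.elim := by
  have hq : PreservesBracket (toFreePoissonHopf k C).toLinearMap := preservesBracket_lift _ _ _
  have hc : PreservesBracket (Bialgebra.comulAlgHom k (FreeOpPoisson k C)).toLinearMap :=
    IsPoissonBialgebra.comul_bracket
  refine algHom_ext (.comp (.tensorMap hq hq) hc) (preservesBracket_lift _ _ _)
    (fun a ha => ?_) fun c => ?_
  · refine .trans ?_ (lift_op (R := ⊥) _ _ (fun _ _ => False.elim) a).symm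
    rw [← ha]
    have e : TensorProduct.map (toFreePoissonHopf k C).toLinearMap
          (toFreePoissonHopf k C).toLinearMap ∘ₗ twist (op ⊥) =
        twist (op AntipodeRel) ∘ₗ TensorProduct.map (toFreePoissonHopf k C).toLinearMap
          (toFreePoissonHopf k C).toLinearMap := by
      ext
      simp [toFreePoissonHopf_op]
    change TensorProduct.map (toFreePoissonHopf k C).toLinearMap
      (toFreePoissonHopf k C).toLinearMap (Coalgebra.comul (R := k) (op ⊥ a)) = _
    rw [comul_op]
    exact LinearMap.congr_fun e _
  · exact TensorProduct.map_map _ _ _ _ _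

/-- The twisted operator applied to `(q ⊗ q) ∘ Δ` is the flip of `(op q ⊗ op q) ∘ Δ`, its two-sided
convolution inverse. For the counit, the operator on `k` is the identity and `ε` is the convolution
unit, hence its own inverse. -/
instance : IsCoalgebraic (AntipodeRel : PoissonTerm k C → PoissonTerm k C → Prop) where
  comul := by
    refine eval_eq_of_antipodeRel _ _ _ map_comp_comulAlgHom_eq_lift ?_ ?_
    · have := LinearMap.toConv_comm_map_comul_mul_toConv_map_comul
        (toConv_op_comp_mul_toConv (k := k) (C := C))
      rwa [← twist_comp_map_comp_comul] at this
    · have := LinearMap.toConv_map_comul_mul_toConv_comm_map_comul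
        (toConv_mul_toConv_op_comp (k := k) (C := C))
      rwa [← twist_comp_map_comp_comul] at this
  counit := by
    have h : toConv (Coalgebra.counit : FreeOpPoisson k C →ₗ[k] k) = 1 := rfl
    refine eval_eq_of_antipodeRel _ _ (Bialgebra.counitAlgHom k (FreeOpPoisson k C)) rfl ?_ ?_
    all_goals
      rw [LinearMap.id_comp]
      exact (congrArg₂ (· * ·) h h).trans (mul_one 1)

variable (k C) in
/-- The projection to the free Poisson Hopf algebra as a map of coalgebras. -/
noncomputable def toFreePoissonHopfCoalgHom : FreeOpPoisson k C →ₗc[k] FreePoissonHopf k C where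
  __ := (toFreePoissonHopf k C).toLinearMap
  counit_comp := by
    refine LinearMap.ext fun a => ?_
    obtain ⟨t, rfl⟩ := mk_surjective _ a
    exact congrArg (Coalgebra.counit (R := k)) (toFreePoissonHopf_mk t)
  map_comp_comul := by
    refine LinearMap.ext fun a => ?_
    obtain ⟨t, rfl⟩ := mk_surjective _ a
    exact (DFunLike.congr_fun map_comp_comulAlgHom_eq_lift _).trans
      (congrArg (Coalgebra.comul (R := k)) (toFreePoissonHopf_mk t).symm)

theorem comp_toFreePoissonHopf_injective {M : Type*} [AddCommGroup M] [Module k M]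
    {f g : FreePoissonHopf k C →ₗ[k] M}
    (h : f ∘ₗ (toFreePoissonHopf k C).toLinearMap = g ∘ₗ (toFreePoissonHopf k C).toLinearMap) :
    f = g := by
  ext a
  obtain ⟨x, rfl⟩ := toFreePoissonHopf_surjective a
  exact LinearMap.congr_fun h x

theorem one_comp_toFreePoissonHopf :
    (1 : WithConv (FreePoissonHopf k C →ₗ[k] FreePoissonHopf k C)).ofConv ∘ₗ
      (toFreePoissonHopf k C).toLinearMap =
    (1 : WithConv (FreeOpPoisson k C →ₗ[k] FreePoissonHopf k C)).ofConv := by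
  ext a
  exact congrArg (algebraMap k _)
    (CoalgHomClass.counit_comp_apply (toFreePoissonHopfCoalgHom k C) a)

/-- The projection is a surjective coalgebra map, so the antipode identities may be checked after
composing with it, where they are the imposed relations. -/
noncomputable instance : HopfAlgebra k (FreePoissonHopf k C) :=
  .ofConvInverse (op AntipodeRel)
    (WithConv.ext <| comp_toFreePoissonHopf_injective <|
      (LinearMap.convMul_comp_coalgHom_distrib (toConv (op AntipodeRel)) (toConv LinearMap.id)
        (toFreePoissonHopfCoalgHom k C)).trans <|
      (congrArg ofConv toConv_op_comp_mul_toConv).trans one_comp_toFreePoissonHopf.symm)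
    (WithConv.ext <| comp_toFreePoissonHopf_injective <|
      (LinearMap.convMul_comp_coalgHom_distrib (toConv LinearMap.id) (toConv (op AntipodeRel))
        (toFreePoissonHopfCoalgHom k C)).trans <|
      (congrArg ofConv toConv_mul_toConv_op_comp).trans one_comp_toFreePoissonHopf.symm)

section liftHopf

variable {Y : Type*} [CommRing Y] [HopfAlgebra k Y] [PoissonAlgebra k Y] [IsPoissonBialgebra k Y]

/-- The extension `φ` of `f` to the free algebra is a coalgebra map, so composing the antipode
identities of `Y` with `φ` gives the required convolution identities. -/
theorem eval_antipode_eq_of_antipodeRel (f : C →ₗc[k] Y) (a b : PoissonTerm k C)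
    (h : AntipodeRel a b) : eval (HopfAlgebra.antipode k) f.toLinearMap a =
      eval (HopfAlgebra.antipode k) f.toLinearMap b := by
  let φ : FreeOpPoisson k C →ₐc[k] Y := liftBialgHom (HopfAlgebra.antipode k) f
    HopfAlgebra.comul_antipode HopfAlgebra.counit_antipode fun _ _ => False.elim
  have one : (1 : WithConv (Y →ₗ[k] Y)).ofConv ∘ₗ (φ : FreeOpPoisson k C →ₗc[k] Y).toLinearMap =
      (1 : WithConv (FreeOpPoisson k C →ₗ[k] Y)).ofConv := by
    ext x
    exact congrArg (algebraMap k _) (CoalgHomClass.counit_comp_apply φ x)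
  refine eval_eq_of_antipodeRel _ _ (φ : FreeOpPoisson k C →ₐ[k] Y) rfl ?_ ?_ a b h
  · have := LinearMap.convMul_comp_coalgHom_distrib (toConv (HopfAlgebra.antipode k))
      (toConv (LinearMap.id (R := k) (M := Y))) (φ : FreeOpPoisson k C →ₗc[k] Y)
    rw [LinearMap.antipode_mul_id] at this
    exact WithConv.ext (this.symm.trans one)
  · have := LinearMap.convMul_comp_coalgHom_distrib
      (toConv (LinearMap.id (R := k) (M := Y))) (toConv (HopfAlgebra.antipode k))
      (φ : FreeOpPoisson k C →ₗc[k] Y)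
    rw [LinearMap.id_mul_antipode] at this
    exact WithConv.ext (this.symm.trans one)

/-- The morphism from the free Poisson Hopf algebra given by a map of coalgebras. -/
noncomputable def liftHopf (f : C →ₗc[k] Y) : FreePoissonHopf k C →ₐc[k] Y :=
  liftBialgHom (HopfAlgebra.antipode k) f HopfAlgebra.comul_antipode HopfAlgebra.counit_antipode
    (eval_antipode_eq_of_antipodeRel f)

theorem preservesBracket_liftHopf (f : C →ₗc[k] Y) :
    PreservesBracket (liftHopf f : FreePoissonHopf k C →ₗ[k] Y) :=
  preservesBracket_lift _ f.toLinearMap (eval_antipode_eq_of_antipodeRel f)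

end liftHopf

/-- Compatibility with `op` is automatic, as `op` is the antipode of the source and bialgebra maps
preserve antipodes. -/
theorem bialgHom_ext {Y : Type*} [CommRing Y] [HopfAlgebra k Y] [PoissonAlgebra k Y]
    {φ ψ : FreePoissonHopf k C →ₐc[k] Y}
    (hφ : PreservesBracket (φ : FreePoissonHopf k C →ₗ[k] Y))
    (hψ : PreservesBracket (ψ : FreePoissonHopf k C →ₗ[k] Y))
    (h : ∀ c, φ (of AntipodeRel c) = ψ (of AntipodeRel c)) : φ = ψ := by
  have := algHom_ext (φ := (φ : FreePoissonHopf k C →ₐ[k] Y))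
    (ψ := (ψ : FreePoissonHopf k C →ₐ[k] Y)) hφ hψ
    (fun a ha => ?_) h
  · exact DFunLike.ext _ _ fun a => DFunLike.congr_fun this a
  · exact (BialgHom.map_antipode φ a).trans
      ((congrArg _ ha).trans (BialgHom.map_antipode ψ a).symm)

end OpPoisson

/-! ### The adjunction. -/

namespace PoissHopfCat

/-- The free Poisson Hopf algebra on a coalgebra. -/
noncomputable def free (k : Type u) [Field k] (C : CoalgCat.{max u v} k) :
    PoissHopfCat.{u, max u v} k where
  carrier := OpPoisson.FreePoissonHopf k C

/-- The unit of the adjunction between free and forgetful functors. -/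
noncomputable def unit (k : Type u) [Field k] (C : CoalgCat.{max u v} k) :
    C ⟶ (forgetCoalg k).obj (free.{u, v} k C) :=
  CoalgCat.Hom.mk (OpPoisson.ofCoalgHom _)

theorem existsUnique_hom (k : Type u) [Field k] (C : CoalgCat.{max u v} k)
    (Y : PoissHopfCat.{u, max u v} k) (f : C ⟶ (forgetCoalg k).obj Y) :
    ∃! g : free.{u, v} k C ⟶ Y, unit k C ≫ (forgetCoalg k).map g = f := by
  let f' : C →ₗc[k] Y := f.toCoalgHom'
  refine ⟨Hom.mk (G := free.{u, v} k C) (OpPoisson.liftHopf f')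
    (OpPoisson.preservesBracket_liftHopf f'), ?_, fun g hg => ?_⟩
  -- Evaluating a generator `of c` returns `f c` by definition.
  · rfl
  · refine Hom.ext (OpPoisson.bialgHom_ext g.map_bracket (OpPoisson.preservesBracket_liftHopf f')
      fun c => ?_)
    exact DFunLike.congr_fun (congrArg CoalgCat.Hom.toCoalgHom' hg) c

/-- The universal property says that the unit is initial among coalgebra maps from `C` to Poisson
Hopf algebras; initial objects in all these comma categories give the left adjoint. -/
theorem isRightAdjoint_forgetCoalg (k : Type u) [Field k] :
    (forgetCoalg.{u, max u v} k).IsRightAdjoint := by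
  have (C : CoalgCat.{max u v} k) : Limits.HasInitial (StructuredArrow C (forgetCoalg k)) := by
    refine Limits.IsInitial.hasInitial (X := StructuredArrow.mk (unit.{u, v} k C)) <|
      Limits.IsInitial.ofUniqueHom
      (fun X => StructuredArrow.homMk (existsUnique_hom k C X.right X.hom).choose
        (existsUnique_hom k C X.right X.hom).choose_spec.1) fun X m => ?_
    refine StructuredArrow.ext _ _ ?_
    exact (existsUnique_hom k C X.right X.hom).choose_spec.2 _ (StructuredArrow.w m)
  exact isRightAdjointOfStructuredArrowInitials _

end PoissHopfCat

theorem theorem3p3 (k : Type u) [Field k] :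
    (PoissHopfCat.forgetCoalg.{u, max u v} k).IsRightAdjoint ∧
      ∀ C : CoalgCat.{max u v} k,
        ∃ (H : PoissHopfCat.{u, max u v} k) (i : C ⟶ (PoissHopfCat.forgetCoalg k).obj H),
          ∀ (Y : PoissHopfCat.{u, max u v} k) (f : C ⟶ (PoissHopfCat.forgetCoalg k).obj Y),
            ∃! g : H ⟶ Y, i ≫ (PoissHopfCat.forgetCoalg k).map g = f :=
  ⟨PoissHopfCat.isRightAdjoint_forgetCoalg.{u, v} k, fun C =>
    ⟨PoissHopfCat.free.{u, v} k C, PoissHopfCat.unit k C, PoissHopfCat.existsUnique_hom k C⟩⟩
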